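/- For $n\in\mathbb N$, $\beta>0$ and $h\in\mathbb C$ let $$Z_n(\beta,h)=\sum_{(\sigma_1,\dots,\sigma_n)\in\{\pm1\}^n}\exp\Big\{\frac{\beta}{2n}\Big(\sum_{k=1}^n\sigma_k\Big)^2+h\sum_{k=1}^n\sigma_k\Big\}$$ be the partition function of the Curie--Weiss model at inverse temperature $\beta$ with complex external field $h$. Fix $\beta>0$. Then the following hold. 1. For every $n\ge1$ there is an analytic branch of $h\mapsto\log Z_n(\beta,h)$ on the half-plane $\{\operatorname{Re}h>0\}$ that is real for real $h$, and likewise on $\{\operatorname{Re}h<0\}$. (Each of these branches is unique; $\log Z_n(\beta,\cdot)$ denotes these branches below.) 2. For every $h\in\mathbb C$ with $\operatorname{Re}h>0$ the equation $\zeta-\beta\tan\zeta=\mathrm ih$ has a unique solution $\zeta=\zeta_\beta(\mathrm ih)$ with $\operatorname{Im}\zeta>0$. 3. For every $h\in\mathbb C$ with $\operatorname{Re}h>0$, $$\lim_{n\to\infty}\frac1n\log Z_n(\beta,h)=\lim_{n\to\infty}\frac1n\log Z_n(\beta,-h)=\frac\beta2+h+\log\big(1+\mathrm e^{2\mathrm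 i\zeta_\beta(\mathrm ih)}\big)-\frac{2\beta}{\big(1+\mathrm e^{-2\mathrm i\zeta_\beta(\mathrm ih)}\big)^2},$$ where the logarithm on the right-hand side is the principal one (its argument has positive real part). -/

import Mathlib

open Filter Topology

/-- The partition function of the Curie-Weiss model with `n` spins (elements of `ℤˣ = {1, -1}`) at
inverse temperature `β` and with complex external field `h`. -/
noncomputable def curieWeissZ (n : ℕ) (β : ℝ) (h : ℂ) : ℂ :=
  ∑ σ : Fin n → ℤˣ,
    Complex.exp ((β : ℂ) / (2 * (n : ℂ)) * (∑ k, ((σ k : ℤ) : ℂ)) ^ 2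
      + h * ∑ k, ((σ k : ℤ) : ℂ))

/-- `ζ` lies in the open upper half-plane and solves `ζ - t tan ζ = θ`. -/
def IsZetaSolution (t : ℝ) (θ ζ : ℂ) : Prop :=
  0 < ζ.im ∧ ζ - (t : ℂ) * Complex.tan ζ = θ

/-- The function `ζ_t(θ)`: the solution of `ζ - t tan ζ = θ` in the open upper half-plane. -/
noncomputable def zetaFun (t : ℝ) (θ : ℂ) : ℂ :=
  Classical.epsilon (IsZetaSolution t θ)

/-- `L` is an analytic branch of `log f` on `U` which is real on the real points of `U`.
For connected `U` meeting the real line and `f` positive on `U ∩ ℝ`, such an `L` is unique on `U`. -/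
def IsLogBranch (U : Set ℂ) (f L : ℂ → ℂ) : Prop :=
  DifferentiableOn ℂ L U ∧
  (∀ h ∈ U, Complex.exp (L h) = f h) ∧
  (∀ x : ℝ, (x : ℂ) ∈ U → (L (x : ℂ)).im = 0)

/-- The free energy `β/2 + h + log (1 + e^{2iζ}) - 2β / (1 + e^{-2iζ})²` with `ζ = ζ_β(ih)`.
Since `Im ζ > 0`, the number `1 + e^{2iζ}` has positive real part, so that the principal logarithm is
the analytic branch that tends to `0` as `Re h → +∞`. -/
noncomputable def curieWeissFreeEnergy (β : ℝ) (h : ℂ) : ℂ :=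
  (β : ℂ) / 2 + h
    + Complex.log (1 + Complex.exp (2 * Complex.I * zetaFun β (Complex.I * h)))
    - 2 * (β : ℂ) / (1 + Complex.exp (-(2 * Complex.I * zetaFun β (Complex.I * h)))) ^ 2

/-! By Lee–Yang, `Z_n = exp (n (β/2 + h)) ∏ (1 - exp (-2h) u_i)` with all `‖u_i‖ = 1`
(`exists_curieWeissZ_eq_prod`). Summing principal logarithms gives the branch on `Re h > 0`, and
`(1/n) log Z_n - β/2 - h` is a power series in `exp (-2h)` with coefficients bounded by 1. Such
series form a normal family, so convergence for real `h > 0` to an analytic function propagates to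
the half-plane (`tendsto_tsum_exp_of_tendsto_real`).

For Lee–Yang, the Gaussian weight is a limit of `cosh (a S / √N) ^ N`. Each factor `cosh` acts on
the polynomial in `exp (-2h)` by an operation that keeps the roots on the unit circle.

For real `h = x > 0`, `Z_n` lies between `exp (n f(m))`, for any `m`, and `(n + 1) exp (n max f)`,
where `f` is the mean-field functional. A nonnegative maximizer satisfies `m = tanh (β m + x)`, so
`y = β m + x` solves `y - β tanh y = x`. This is the equation for `ζ` after `ζ = i y`.

For complex `h` the map `y ↦ h + β tanh y` strictly decreases the pseudo-hyperbolic distance of the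
right half-plane, so it has exactly one fixed point there. The fixed point is analytic in `h`, hence
so is the claimed limit. The left half-plane follows by flipping all spins. -/

/-! ### Polynomials with all roots on the unit circle -/

open Polynomial in
/-- A complex polynomial of degree `n` is a product of `n` linear factors, indexed by `Fin n`. -/
lemma exists_eval_eq_leadingCoeff_mul_prod {n : ℕ} (P : ℂ[X]) (hn : P.natDegree = n) :
    ∃ ρ : Fin n → ℂ, ∀ z, P.eval z = P.leadingCoeff * ∏ i, (z - ρ i) := by
  have hs := IsAlgClosed.splits P
  have hcard : P.roots.card = n := by rw [← hn]; exact hs.natDegree_eq_card_roots.symm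
  obtain ⟨l, hl⟩ := Quot.exists_rep P.roots
  have hlen : l.length = n := by rw [← hcard, ← hl]; rfl
  subst hlen
  refine ⟨l.get, fun z => ?_⟩
  rw [hs.eval_eq_prod_roots, ← hl]
  congr 1
  change (Multiset.map _ (l : Multiset ℂ)).prod = _
  rw [Multiset.map_coe, Multiset.prod_coe, ← List.prod_ofFn]
  congr 1
  apply List.ext_get <;> simp

/-- The points `ρ / l` and `l ρ` are inverse in the unit circle, so which of the two weighted
distances is larger depends only on the side of the circle on which `z` lies. -/
lemma norm_sq_sub_norm_sq (l : ℝ) (z ρ : ℂ) (hρ : ‖ρ‖ = 1) :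
    ‖l * z - ρ‖ ^ 2 - ‖z - l * ρ‖ ^ 2 = (l ^ 2 - 1) * (‖z‖ ^ 2 - 1) := by
  have h1 : ‖ρ‖ ^ 2 = 1 := by rw [hρ]; norm_num
  simp only [← Complex.normSq_eq_norm_sq, Complex.normSq_apply, Complex.sub_re, Complex.sub_im,
    Complex.mul_re, Complex.mul_im, Complex.ofReal_re, Complex.ofReal_im] at h1 ⊢
  linear_combination (1 - l ^ 2) * h1

lemma norm_sub_mul_lt {l : ℝ} (hl : 1 < l) {z ρ : ℂ} (hρ : ‖ρ‖ = 1) (hz : 1 < ‖z‖) :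
    ‖z - l * ρ‖ < ‖l * z - ρ‖ := by
  refine lt_of_pow_lt_pow_left₀ 2 (norm_nonneg _) ?_
  have := norm_sq_sub_norm_sq l z ρ hρ
  nlinarith [mul_pos (show 0 < l ^ 2 - 1 by nlinarith) (show 0 < ‖z‖ ^ 2 - 1 by nlinarith)]

lemma norm_mul_sub_lt {l : ℝ} (hl : 1 < l) {z ρ : ℂ} (hρ : ‖ρ‖ = 1) (hz : ‖z‖ < 1) :
    ‖l * z - ρ‖ < ‖z - l * ρ‖ := by
  refine lt_of_pow_lt_pow_left₀ 2 (norm_nonneg _) ?_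
  have := norm_sq_sub_norm_sq l z ρ hρ
  nlinarith [mul_pos (show 0 < l ^ 2 - 1 by nlinarith)
    (show 0 < 1 - ‖z‖ ^ 2 by nlinarith [norm_nonneg z])]

lemma norm_prod_lt_norm_prod {n : ℕ} (hn : 1 ≤ n) {f g : Fin n → ℂ} (h : ∀ i, ‖f i‖ < ‖g i‖) :
    ‖∏ i, f i‖ < ‖∏ i, g i‖ := by
  have : Nonempty (Fin n) := ⟨⟨0, hn⟩⟩
  rw [norm_prod, norm_prod]
  by_cases h0 : ∃ i, ‖f i‖ = 0
  · obtain ⟨i, hi⟩ := h0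
    rw [Finset.prod_eq_zero (Finset.mem_univ i) hi]
    exact Finset.prod_pos fun i _ => (norm_nonneg _).trans_lt (h i)
  · push Not at h0
    exact Finset.prod_lt_prod_of_nonempty
      (fun i _ => lt_of_le_of_ne (norm_nonneg _) (h0 i).symm) (fun i _ => h i)
      Finset.univ_nonempty

/-- If all roots of `P` lie on the unit circle, then so do all roots of
`P (l z) + l ^ n P (z / l)`. -/
lemma norm_eq_one_of_scaled_add_eq_zero {n : ℕ} (hn : 1 ≤ n) {P : Polynomial ℂ}
    (hdeg : P.natDegree = n) (hroots : ∀ z, P.eval z = 0 → ‖z‖ = 1) {l : ℝ} (hl : 1 < l) {z : ℂ}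
    (hz : P.eval (l * z) + l ^ n * P.eval (z / l) = 0) : ‖z‖ = 1 := by
  obtain ⟨ρ, hρ⟩ := exists_eval_eq_leadingCoeff_mul_prod P hdeg
  have hl0 : (l : ℂ) ≠ 0 := by exact_mod_cast (by linarith : l ≠ 0)
  have hP0 : P.leadingCoeff ≠ 0 := by
    rw [Polynomial.leadingCoeff_ne_zero]
    rintro rfl
    simp at hdeg
    omega
  have hρ1 : ∀ i, ‖ρ i‖ = 1 := fun i => hroots _ (by
    rw [hρ, Finset.prod_eq_zero (Finset.mem_univ i) (sub_self _), mul_zero])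
  have h2 : (l : ℂ) ^ n * ∏ i, (z / l - ρ i) = ∏ i, (z - l * ρ i) := by
    have : (l : ℂ) ^ n = ∏ _i : Fin n, (l : ℂ) := by simp
    rw [this, ← Finset.prod_mul_distrib]
    refine Finset.prod_congr rfl fun i _ => ?_
    field_simp
  rw [hρ, hρ, mul_left_comm, h2, ← mul_add, mul_eq_zero, or_iff_right hP0] at hz
  have hnorm : ‖∏ i, (l * z - ρ i)‖ = ‖∏ i, (z - l * ρ i)‖ := by
    rw [eq_neg_of_add_eq_zero_left hz, norm_neg]
  -- Off the circle all factors compare strictly in the same direction, so the two products cannot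
  -- have equal norm.
  rcases lt_trichotomy ‖z‖ 1 with h | h | h
  · exact absurd hnorm (norm_prod_lt_norm_prod hn fun i => norm_mul_sub_lt hl (hρ1 i) h).ne
  · exact h
  · exact absurd hnorm (norm_prod_lt_norm_prod hn fun i => norm_sub_mul_lt hl (hρ1 i) h).ne'

/-! ### Spin sums as polynomials -/

/-- The number of spins equal to `-1`. -/
def downCount {n : ℕ} (σ : Fin n → ℤˣ) : ℕ := (Finset.univ.filter fun i => σ i = -1).card

lemma downCount_le {n : ℕ} (σ : Fin n → ℤˣ) : downCount σ ≤ n :=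
  (Finset.card_filter_le _ _).trans (by simp)

lemma downCount_eq_iff {n : ℕ} (σ : Fin n → ℤˣ) : downCount σ = n ↔ σ = fun _ => -1 := by
  constructor
  · intro h
    have h' : (Finset.univ.filter fun i => σ i = -1).card = (Finset.univ : Finset (Fin n)).card := by
      rw [Finset.card_univ, Fintype.card_fin]; exact h
    funext i
    exact Finset.card_filter_eq_iff.1 h' i (Finset.mem_univ i)
  · rintro rfl
    simp [downCount]

lemma downCount_eq_zero_iff {n : ℕ} (σ : Fin n → ℤˣ) : downCount σ = 0 ↔ σ = fun _ => 1 := by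
  rw [downCount, Finset.card_eq_zero, Finset.filter_eq_empty_iff]
  constructor
  · intro h
    funext i
    exact (Int.units_eq_one_or (σ i)).resolve_right (h (Finset.mem_univ i))
  · rintro rfl i - h
    exact absurd (show (1 : ℤˣ) = -1 from h) (by decide)

lemma sum_spin {n : ℕ} (σ : Fin n → ℤˣ) : ∑ k, ((σ k : ℤ) : ℝ) = n - 2 * downCount σ := by
  have : ∀ k, ((σ k : ℤ) : ℝ) = 1 - 2 * (if σ k = -1 then 1 else 0) := by
    intro k
    rcases Int.units_eq_one_or (σ k) with h | h
    · rw [h, if_neg (by decide)]; norm_num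
    · rw [h, if_pos rfl]; norm_num
  simp_rw [this]
  rw [Finset.sum_sub_distrib, ← Finset.mul_sum, Finset.sum_boole]
  simp [downCount]

/-- The polynomial with a monomial `c σ * X ^ (number of spins of σ equal to -1)` for each spin
configuration `σ`. -/
noncomputable def spinPoly {n : ℕ} (c : (Fin n → ℤˣ) → ℂ) : Polynomial ℂ :=
  ∑ σ, Polynomial.C (c σ) * Polynomial.X ^ downCount σ

lemma eval_spinPoly {n : ℕ} (c : (Fin n → ℤˣ) → ℂ) (z : ℂ) :
    (spinPoly c).eval z = ∑ σ, c σ * z ^ downCount σ := by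
  simp [spinPoly, Polynomial.eval_finsetSum]

lemma coeff_spinPoly {n : ℕ} (c : (Fin n → ℤˣ) → ℂ) :
    (spinPoly c).coeff n = c fun _ => -1 := by
  simp only [spinPoly, Polynomial.finsetSum_coeff, Polynomial.coeff_C_mul_X_pow]
  simp_rw [eq_comm (a := n), downCount_eq_iff]
  simp

lemma eval_zero_spinPoly {n : ℕ} (c : (Fin n → ℤˣ) → ℂ) :
    (spinPoly c).eval 0 = c fun _ => 1 := by
  rw [eval_spinPoly]
  simp_rw [zero_pow_eq, downCount_eq_zero_iff]
  simp

lemma natDegree_spinPoly {n : ℕ} {c : (Fin n → ℤˣ) → ℂ} (hc : (c fun _ => -1) ≠ 0) :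
    (spinPoly c).natDegree = n := by
  refine Polynomial.natDegree_eq_of_le_of_coeff_ne_zero ?_ (by rwa [coeff_spinPoly])
  refine Polynomial.natDegree_sum_le_of_forall_le _ _ fun σ _ => ?_
  exact (Polynomial.natDegree_C_mul_X_pow_le _ _).trans (downCount_le σ)

lemma leadingCoeff_spinPoly {n : ℕ} {c : (Fin n → ℤˣ) → ℂ} (hc : (c fun _ => -1) ≠ 0) :
    (spinPoly c).leadingCoeff = c fun _ => -1 := by
  rw [Polynomial.leadingCoeff, natDegree_spinPoly hc, coeff_spinPoly]

lemma eval_spinPoly_one {n : ℕ} (z : ℂ) :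
    (spinPoly fun _ : Fin n → ℤˣ => 1).eval z = (1 + z) ^ n := by
  rw [eval_spinPoly]
  have h1 : ∀ σ : Fin n → ℤˣ, (1 : ℂ) * z ^ downCount σ = ∏ i, if σ i = -1 then z else 1 := by
    intro σ
    rw [Finset.prod_ite]
    simp [downCount]
  simp_rw [h1]
  have h2 := Finset.prod_univ_sum (fun _ : Fin n => (Finset.univ : Finset ℤˣ))
    (fun _ s => if s = -1 then z else (1 : ℂ))
  rw [Fintype.piFinset_univ] at h2
  rw [← h2]
  have h3 : (∑ s : ℤˣ, if s = -1 then z else (1 : ℂ)) = 1 + z := by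
    have : (Finset.univ : Finset ℤˣ) = {1, -1} := by decide
    rw [this, Finset.sum_pair (by decide)]
    simp [show (1 : ℤˣ) ≠ -1 by decide]
  rw [h3]
  simp

/-! ### The Lee–Yang theorem -/

/-- The magnetization of a spin configuration. -/
noncomputable def magnetization {n : ℕ} (σ : Fin n → ℤˣ) : ℝ := n - 2 * downCount σ

/-- The weights `cosh (a S) ^ N`, with `S` the magnetization. -/
noncomputable def coshWeight (n : ℕ) (a : ℝ) (N : ℕ) (σ : Fin n → ℤˣ) : ℂ :=
  ((Real.cosh (a * magnetization σ) ^ N : ℝ) : ℂ)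

lemma coshWeight_ne_zero (n : ℕ) (a : ℝ) (N : ℕ) (σ : Fin n → ℤˣ) : coshWeight n a N σ ≠ 0 := by
  unfold coshWeight
  exact_mod_cast (pow_pos (Real.cosh_pos _) N).ne'

lemma one_le_norm_coshWeight (n : ℕ) (a : ℝ) (N : ℕ) (σ : Fin n → ℤˣ) :
    1 ≤ ‖coshWeight n a N σ‖ := by
  unfold coshWeight
  rw [Complex.norm_real, Real.norm_of_nonneg (pow_pos (Real.cosh_pos _) N).le]
  exact one_le_pow₀ (Real.one_le_cosh _)

/-- With `l = exp (2a)` and `k` down spins, `2 exp (a n) cosh (a (n - 2k)) = l ^ k + l ^ (n - k)`.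
One more `cosh` factor is thus the circle-preserving operation of
`norm_eq_one_of_scaled_add_eq_zero`. -/
lemma eval_spinPoly_coshWeight_succ (n : ℕ) (a : ℝ) (N : ℕ) (z : ℂ) :
    2 * Real.exp (a * n) * (spinPoly (coshWeight n a (N + 1))).eval z =
      (spinPoly (coshWeight n a N)).eval (Real.exp (2 * a) * z)
        + (Real.exp (2 * a) : ℂ) ^ n * (spinPoly (coshWeight n a N)).eval (z / Real.exp (2 * a)) := by
  simp only [eval_spinPoly, Finset.mul_sum, ← Finset.sum_add_distrib]
  refine Finset.sum_congr rfl fun σ _ => ?_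
  have key : 2 * Real.exp (a * n) * Real.cosh (a * magnetization σ) =
      Real.exp (2 * a) ^ downCount σ + Real.exp (2 * a) ^ n / Real.exp (2 * a) ^ downCount σ := by
    rw [Real.cosh_eq, magnetization, ← Real.exp_nat_mul, ← Real.exp_nat_mul, ← Real.exp_sub]
    have e1 : (downCount σ : ℝ) * (2 * a) = a * n + -(a * (n - 2 * downCount σ)) := by ring
    have e2 : (n : ℝ) * (2 * a) - (downCount σ : ℝ) * (2 * a)
      = a * n + a * (n - 2 * downCount σ) := by ring
    rw [e2, e1, Real.exp_add, Real.exp_add]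
    ring
  have key' := congrArg (fun x : ℝ => (x : ℂ)) key
  simp only [coshWeight, Complex.ofReal_mul, Complex.ofReal_add, Complex.ofReal_div,
    Complex.ofReal_pow, Complex.ofReal_ofNat] at key' ⊢
  rw [mul_pow, div_pow, pow_succ]
  linear_combination (Real.cosh (a * magnetization σ) : ℂ) ^ N * z ^ downCount σ * key'

lemma norm_eq_one_of_eval_coshWeight {n : ℕ} (hn : 1 ≤ n) {a : ℝ} (ha : 0 < a) (N : ℕ) :
    ∀ z, (spinPoly (coshWeight n a N)).eval z = 0 → ‖z‖ = 1 := by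
  induction N with
  | zero =>
    intro z hz
    have : coshWeight n a 0 = fun _ => 1 := by funext σ; simp [coshWeight]
    rw [this, eval_spinPoly_one] at hz
    have := eq_neg_of_add_eq_zero_right (pow_eq_zero_iff (by omega) |>.1 hz)
    rw [this]; simp
  | succ N ih =>
    intro z hz
    refine norm_eq_one_of_scaled_add_eq_zero hn
      (natDegree_spinPoly (coshWeight_ne_zero n a N _)) ih
      (Real.one_lt_exp_iff.2 (by linarith : 0 < 2 * a)) ?_ (z := z)
    rw [← eval_spinPoly_coshWeight_succ, hz, mul_zero]

/-- A form of root location that is uniform in `N`, hence survives `N → ∞` without Hurwitz's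
theorem: the leading coefficient has norm at least 1 and every root is at distance at least `|‖z‖ -
1|` from `z`. -/
lemma abs_pow_le_norm_eval_coshWeight {n : ℕ} (hn : 1 ≤ n) {a : ℝ} (ha : 0 < a) (N : ℕ) (z : ℂ) :
    |‖z‖ - 1| ^ n ≤ ‖(spinPoly (coshWeight n a N)).eval z‖ := by
  obtain ⟨ρ, hρ⟩ := exists_eval_eq_leadingCoeff_mul_prod (spinPoly (coshWeight n a N))
    (natDegree_spinPoly (coshWeight_ne_zero n a N _))
  have hρ1 : ∀ i, ‖ρ i‖ = 1 := fun i => norm_eq_one_of_eval_coshWeight hn ha N _ (by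
    rw [hρ, Finset.prod_eq_zero (Finset.mem_univ i) (sub_self _), mul_zero])
  rw [hρ, leadingCoeff_spinPoly (coshWeight_ne_zero n a N _), norm_mul, norm_prod]
  have h1 : |‖z‖ - 1| ^ n ≤ ∏ i, ‖z - ρ i‖ := by
    have : |‖z‖ - 1| ^ n = ∏ _i : Fin n, |‖z‖ - 1| := by simp
    rw [this]
    refine Finset.prod_le_prod (fun _ _ => abs_nonneg _) fun i _ => ?_
    rw [← hρ1 i]
    exact abs_norm_sub_norm_le _ _
  calc |‖z‖ - 1| ^ n ≤ 1 * ∏ i, ‖z - ρ i‖ := by rwa [one_mul]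
    _ ≤ _ := mul_le_mul_of_nonneg_right (one_le_norm_coshWeight n a N _)
      (Finset.prod_nonneg fun _ _ => norm_nonneg _)

lemma sq_le_sinh_sq (x : ℝ) : x ^ 2 ≤ Real.sinh x ^ 2 := by
  rcases le_total 0 x with h | h
  · exact pow_le_pow_left₀ h (Real.self_le_sinh_iff.2 h) 2
  · rw [← neg_sq x, ← neg_sq (Real.sinh x)]
    exact pow_le_pow_left₀ (by linarith) (neg_le_neg (Real.sinh_le_self_iff.2 h)) 2

lemma one_add_sq_div_two_le_cosh (x : ℝ) : 1 + x ^ 2 / 2 ≤ Real.cosh x := by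
  have h := Real.cosh_two_mul (x / 2)
  rw [show 2 * (x / 2) = x by ring, Real.cosh_sq] at h
  nlinarith [sq_le_sinh_sq (x / 2)]

/-- Squeeze from `1 + t² / 2 ≤ cosh t ≤ exp (t² / 2)` at `t = x / √N`. -/
lemma tendsto_cosh_div_sqrt_pow (x : ℝ) :
    Tendsto (fun N : ℕ => Real.cosh (x / √N) ^ N) atTop (𝓝 (Real.exp (x ^ 2 / 2))) := by
  have hlow := Real.tendsto_one_add_div_pow_exp (x ^ 2 / 2)
  refine tendsto_of_tendsto_of_tendsto_of_le_of_le' hlow tendsto_const_nhds ?_ ?_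
  · filter_upwards [eventually_gt_atTop 0] with N hN
    have hN' : (0 : ℝ) < N := by exact_mod_cast hN
    refine pow_le_pow_left₀ (by positivity) ?_ N
    have h := one_add_sq_div_two_le_cosh (x / √N)
    rw [div_pow, Real.sq_sqrt hN'.le] at h
    calc 1 + x ^ 2 / 2 / N = 1 + x ^ 2 / N / 2 := by ring
      _ ≤ _ := h
  · filter_upwards [eventually_gt_atTop 0] with N hN
    have hN' : (0 : ℝ) < N := by exact_mod_cast hN
    calc Real.cosh (x / √N) ^ N ≤ Real.exp ((x / √N) ^ 2 / 2) ^ N :=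
          pow_le_pow_left₀ (Real.cosh_pos _).le (Real.cosh_le_exp_half_sq _) N
      _ = Real.exp (x ^ 2 / 2) := by
        rw [← Real.exp_nat_mul, div_pow, Real.sq_sqrt hN'.le]
        congr 1
        field_simp

/-- The Boltzmann weights of the Curie-Weiss model without external field. -/
noncomputable def curieWeissWeight (n : ℕ) (β : ℝ) (σ : Fin n → ℤˣ) : ℂ :=
  (Real.exp (β / (2 * n) * magnetization σ ^ 2) : ℝ)

/-- The Lee-Yang theorem for the Curie-Weiss model. -/
lemma norm_eq_one_of_eval_curieWeissWeight {n : ℕ} (hn : 1 ≤ n) {β : ℝ} (hβ : 0 < β) {z : ℂ}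
    (hz : (spinPoly (curieWeissWeight n β)).eval z = 0) : ‖z‖ = 1 := by
  have hn' : (0 : ℝ) < n := by exact_mod_cast hn
  have hlim : Tendsto (fun N : ℕ => (spinPoly (coshWeight n (√(β / n) / √N) N)).eval z) atTop
      (𝓝 ((spinPoly (curieWeissWeight n β)).eval z)) := by
    simp only [eval_spinPoly]
    refine tendsto_finsetSum _ fun σ _ => Tendsto.mul_const _ ?_
    have h := tendsto_cosh_div_sqrt_pow (√(β / n) * magnetization σ)
    have e : (√(β / n) * magnetization σ) ^ 2 / 2 = β / (2 * n) * magnetization σ ^ 2 := by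
      rw [mul_pow, Real.sq_sqrt (by positivity)]
      field_simp
    rw [e] at h
    refine ((Complex.continuous_ofReal.tendsto _).comp h).congr fun N => ?_
    simp only [coshWeight, Function.comp]
    rw [div_mul_eq_mul_div]
  have hle : |‖z‖ - 1| ^ n ≤ ‖(spinPoly (curieWeissWeight n β)).eval z‖ := by
    refine ge_of_tendsto hlim.norm ?_
    filter_upwards [eventually_gt_atTop 0] with N hN
    have hN' : (0 : ℝ) < N := by exact_mod_cast hN
    exact abs_pow_le_norm_eval_coshWeight hn (by positivity) N z
  rw [hz, norm_zero] at hle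
  have := pow_eq_zero_iff (by omega) |>.1 (le_antisymm hle (by positivity))
  linarith [abs_eq_zero.1 this]

lemma curieWeissZ_eq (n : ℕ) (β : ℝ) (h : ℂ) :
    curieWeissZ n β h
      = Complex.exp (n * h) * (spinPoly (curieWeissWeight n β)).eval (Complex.exp (-2 * h)) := by
  rw [curieWeissZ, eval_spinPoly, Finset.mul_sum]
  refine Finset.sum_congr rfl fun σ _ => ?_
  have hs : ∑ k, ((σ k : ℤ) : ℂ) = n - 2 * downCount σ := by exact_mod_cast sum_spin σ
  rw [hs, curieWeissWeight, magnetization, ← Complex.exp_nat_mul, Complex.ofReal_exp,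
    ← Complex.exp_add, ← Complex.exp_add]
  congr 1
  push_cast
  ring

/-- The factorization of the Curie-Weiss partition function over the Lee-Yang zeros. -/
lemma exists_curieWeissZ_eq_prod {n : ℕ} (hn : 1 ≤ n) {β : ℝ} (hβ : 0 < β) :
    ∃ u : Fin n → ℂ, (∀ i, ‖u i‖ = 1) ∧ ∀ h, curieWeissZ n β h =
      Complex.exp (n * (β / 2 + h)) * ∏ i, (1 - Complex.exp (-2 * h) * u i) := by
  have hc : (curieWeissWeight n β fun _ => -1) ≠ 0 := by
    unfold curieWeissWeight
    exact_mod_cast (Real.exp_pos _).ne'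
  obtain ⟨ρ, hρ⟩ := exists_eval_eq_leadingCoeff_mul_prod _ (natDegree_spinPoly hc)
  have hρ1 : ∀ i, ‖ρ i‖ = 1 := fun i => norm_eq_one_of_eval_curieWeissWeight hn hβ (by
    rw [hρ, Finset.prod_eq_zero (Finset.mem_univ i) (sub_self _), mul_zero])
  have hρ0 : ∀ i, ρ i ≠ 0 := fun i h => by simpa [h] using hρ1 i
  -- Reciprocal roots normalize the product to 1 at `z = 0`; the constant term comes from the all-up
  -- configuration.
  refine ⟨fun i => (ρ i)⁻¹, fun i => by rw [norm_inv, hρ1, inv_one], fun h => ?_⟩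
  have h0 : (spinPoly (curieWeissWeight n β)).eval 0 = Complex.exp (n * (β / 2)) := by
    rw [eval_zero_spinPoly, curieWeissWeight, magnetization, (downCount_eq_zero_iff _).2 rfl]
    have hn' : (n : ℂ) ≠ 0 := by exact_mod_cast (by omega : n ≠ 0)
    push_cast
    congr 1
    field_simp
    ring
  have hev : ∀ z, (spinPoly (curieWeissWeight n β)).eval z
      = (spinPoly (curieWeissWeight n β)).eval 0 * ∏ i, (1 - z * (ρ i)⁻¹) := by
    intro z
    rw [hρ z, hρ 0, mul_assoc, ← Finset.prod_mul_distrib]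
    congr 1
    refine Finset.prod_congr rfl fun i _ => ?_
    have := hρ0 i
    field_simp
    ring
  rw [curieWeissZ_eq, hev, h0, ← mul_assoc, ← Complex.exp_add]
  congr 2
  ring

/-! ### Schwarz–Pick inequalities for `sinh` and `tanh` -/

/-- `sinh` is convex on `[0, ∞)` and vanishes at 0, so `sinh s / s` is nondecreasing. -/
lemma sinh_mul_le_sinh_mul {d s : ℝ} (hd : 0 ≤ d) (hds : d ≤ s) :
    Real.sinh d * s ≤ Real.sinh s * d := by
  rcases hd.eq_or_lt with rfl | hd
  · simp
  have hconv : ConvexOn ℝ (Set.Ici 0) Real.sinh := by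
    refine MonotoneOn.convexOn_of_deriv (convex_Ici 0) Real.continuous_sinh.continuousOn
      Real.differentiable_sinh.differentiableOn ?_
    rw [interior_Ici, Real.deriv_sinh]
    exact Real.cosh_strictMonoOn.monotoneOn.mono Set.Ioi_subset_Ici_self
  have hs : 0 < s := hd.trans_le hds
  have h := hconv.2 (Set.mem_Ici.2 hs.le) (Set.mem_Ici.2 le_rfl)
    (show 0 ≤ d / s by positivity) (show 0 ≤ 1 - d / s by
      rw [sub_nonneg, div_le_one hs]; exact hds) (by ring)
  simp only [smul_eq_mul, mul_zero, Real.sinh_zero, add_zero] at h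
  rw [div_mul_cancel₀ _ hs.ne'] at h
  calc Real.sinh d * s ≤ d / s * Real.sinh s * s := mul_le_mul_of_nonneg_right h hs.le
    _ = Real.sinh s * d := by field_simp

lemma sinh_eq_mk (z : ℂ) :
    Complex.sinh z = ⟨Real.sinh z.re * Real.cos z.im, Real.cosh z.re * Real.sin z.im⟩ := by
  conv_lhs => rw [← Complex.re_add_im z, Complex.sinh_add, Complex.cosh_mul_I,
    Complex.sinh_mul_I, ← Complex.ofReal_sinh, ← Complex.ofReal_cosh, ← Complex.ofReal_sin,
    ← Complex.ofReal_cos]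
  apply Complex.ext <;> simp [-Complex.ofReal_sinh, -Complex.ofReal_cosh, -Complex.ofReal_sin,
    -Complex.ofReal_cos]

lemma cosh_eq_mk (z : ℂ) :
    Complex.cosh z = ⟨Real.cosh z.re * Real.cos z.im, Real.sinh z.re * Real.sin z.im⟩ := by
  conv_lhs => rw [← Complex.re_add_im z, Complex.cosh_add, Complex.cosh_mul_I,
    Complex.sinh_mul_I, ← Complex.ofReal_sinh, ← Complex.ofReal_cosh, ← Complex.ofReal_sin,
    ← Complex.ofReal_cos]
  apply Complex.ext <;> simp [-Complex.ofReal_sinh, -Complex.ofReal_cosh, -Complex.ofReal_sin,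
    -Complex.ofReal_cos]

lemma normSq_sinh (z : ℂ) :
    Complex.normSq (Complex.sinh z) = Real.sinh z.re ^ 2 + Real.sin z.im ^ 2 := by
  rw [sinh_eq_mk, Complex.normSq_mk]
  linear_combination Real.sinh z.re ^ 2 * Real.sin_sq_add_cos_sq z.im
    + Real.sin z.im ^ 2 * Real.cosh_sq z.re

lemma normSq_cosh (z : ℂ) :
    Complex.normSq (Complex.cosh z) = Real.sinh z.re ^ 2 + 1 - Real.sin z.im ^ 2 := by
  rw [cosh_eq_mk, Complex.normSq_mk]
  linear_combination Real.cosh z.re ^ 2 * Real.sin_sq_add_cos_sq z.im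
    + (1 - Real.sin z.im ^ 2) * Real.cosh_sq z.re

lemma normSq_cosh_pos {z : ℂ} (hz : 0 < z.re) : 0 < Complex.normSq (Complex.cosh z) := by
  rw [normSq_cosh]
  have := pow_pos (Real.sinh_pos_iff.2 hz) 2
  linarith [Real.sin_sq_le_one z.im]

lemma cosh_ne_zero_of_re_pos {z : ℂ} (hz : 0 < z.re) : Complex.cosh z ≠ 0 :=
  Complex.normSq_pos.1 (normSq_cosh_pos hz)

lemma tanh_re (z : ℂ) :
    (Complex.tanh z).re = Real.sinh (2 * z.re) / (2 * Complex.normSq (Complex.cosh z)) := by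
  rw [Complex.tanh_eq_sinh_div_cosh, Complex.div_re, ← add_div, mul_comm (2 : ℝ) (Complex.normSq _),
    ← div_div, div_right_comm]
  congr 1
  rw [sinh_eq_mk, cosh_eq_mk, Real.sinh_two_mul]
  dsimp only
  linear_combination Real.sinh z.re * Real.cosh z.re * Real.sin_sq_add_cos_sq z.im

lemma tanh_re_pos {z : ℂ} (hz : 0 < z.re) : 0 < (Complex.tanh z).re := by
  rw [tanh_re]
  exact div_pos (Real.sinh_pos_iff.2 (by linarith)) (by linarith [normSq_cosh_pos hz])

lemma norm_tanh_le {δ : ℝ} (hδ : 0 < δ) {z : ℂ} (hz : δ ≤ z.re) :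
    ‖Complex.tanh z‖ ≤ Real.cosh δ / Real.sinh δ := by
  have hs := Real.sinh_pos_iff.2 hδ
  have hc := cosh_ne_zero_of_re_pos (hδ.trans_le hz)
  rw [Complex.tanh_eq_sinh_div_cosh, norm_div, div_le_div_iff₀ (norm_pos_iff.2 hc) hs]
  refine le_of_sq_le_sq ?_ (mul_nonneg (Real.cosh_pos _).le (norm_nonneg _))
  rw [mul_pow, mul_pow, ← Complex.normSq_eq_norm_sq, ← Complex.normSq_eq_norm_sq, normSq_sinh,
    normSq_cosh, Real.cosh_sq]
  have h1 : Real.sinh δ ^ 2 ≤ Real.sinh z.re ^ 2 :=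
    pow_le_pow_left₀ hs.le (Real.sinh_le_sinh.2 hz) 2
  nlinarith [Real.sin_sq_le_one z.im, mul_nonneg (sq_nonneg (Real.sinh δ))
    (sub_nonneg.2 (Real.sin_sq_le_one z.im))]

/-- The Schwarz-Pick inequality for `sinh`. -/
lemma norm_sinh_mul_norm_le {v w : ℂ} (him : v.im = w.im) (hre : |v.re| ≤ w.re) :
    ‖Complex.sinh v‖ * ‖w‖ ≤ ‖v‖ * ‖Complex.sinh w‖ := by
  refine le_of_sq_le_sq ?_ (by positivity)
  simp only [mul_pow, ← Complex.normSq_eq_norm_sq, normSq_sinh]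
  simp only [Complex.normSq_apply, ← him]
  have h1 : Real.sinh v.re ^ 2 * w.re ^ 2 ≤ Real.sinh w.re ^ 2 * v.re ^ 2 := by
    have h := pow_le_pow_left₀ (mul_nonneg (Real.sinh_nonneg_iff.2 (abs_nonneg _))
      ((abs_nonneg _).trans hre)) (sinh_mul_le_sinh_mul (abs_nonneg _) hre) 2
    rwa [mul_pow, mul_pow, ← Real.abs_sinh, sq_abs, sq_abs] at h
  have h2 : v.re ^ 2 ≤ w.re ^ 2 := by
    rw [← sq_abs]; exact pow_le_pow_left₀ (abs_nonneg _) hre 2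
  have h3 : Real.sin v.im ^ 2 ≤ v.im ^ 2 := sq_le_sq.2 Real.abs_sin_le_abs
  have h4 := sq_le_sinh_sq v.re
  have h5 := sq_le_sinh_sq w.re
  have h6 : w.re ^ 2 - v.re ^ 2 ≤ Real.sinh w.re ^ 2 - Real.sinh v.re ^ 2 := by
    rcases (sq_nonneg v.re).eq_or_lt with h | h
    · have : v.re = 0 := by simpa using h.symm
      simp [this, h5]
    · nlinarith
  -- With `t` the common imaginary part, the cross terms obey `sin² t (w² - v²) ≤ t² (w² - v²) ≤ t²
  -- (sinh² w - sinh² v)` in the real parts; `h1` handles the rest.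
  nlinarith [mul_nonneg (sub_nonneg.2 h3) (sub_nonneg.2 h2),
    mul_nonneg (sq_nonneg v.im) (sub_nonneg.2 h6)]

/-- The Schwarz-Pick inequality for `tanh` on the right half-plane. -/
lemma norm_tanh_sub_mul_norm_le {a b : ℂ} (ha : 0 < a.re) (hb : 0 < b.re) :
    ‖Complex.tanh a - Complex.tanh b‖ * ‖a + starRingEnd ℂ b‖ ≤
      ‖a - b‖ * ‖Complex.tanh a + starRingEnd ℂ (Complex.tanh b)‖ := by
  have hca := cosh_ne_zero_of_re_pos ha
  have hcb := cosh_ne_zero_of_re_pos hb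
  have hcb' : starRingEnd ℂ (Complex.cosh b) ≠ 0 := (map_ne_zero _).2 hcb
  have h1 : Complex.tanh a - Complex.tanh b
      = Complex.sinh (a - b) / (Complex.cosh a * Complex.cosh b) := by
    rw [Complex.tanh_eq_sinh_div_cosh, Complex.tanh_eq_sinh_div_cosh, div_sub_div _ _ hca hcb,
      Complex.sinh_sub]
  have h2 : Complex.tanh a + starRingEnd ℂ (Complex.tanh b)
      = Complex.sinh (a + starRingEnd ℂ b) / (Complex.cosh a * starRingEnd ℂ (Complex.cosh b)) := by
    rw [Complex.tanh_eq_sinh_div_cosh, Complex.tanh_eq_sinh_div_cosh, map_div₀,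
      div_add_div _ _ hca hcb', Complex.sinh_add, Complex.sinh_conj, Complex.cosh_conj]
  -- The denominators in `h1` and `h2` have equal modulus, which leaves the inequality for `sinh`.
  have h := norm_sinh_mul_norm_le (v := a - b) (w := a + starRingEnd ℂ b) (by simp; ring)
    (by simp only [Complex.sub_re, Complex.add_re, Complex.conj_re, abs_le]
        constructor <;> linarith)
  rw [h1, h2, norm_div, norm_div, norm_mul, norm_mul, Complex.norm_conj, div_mul_eq_mul_div,
    ← mul_div_assoc]
  exact div_le_div_of_nonneg_right h (by positivity)

lemma norm_lt_norm_ofReal_add {r : ℝ} (hr : 0 < r) {w : ℂ} (hw : 0 < w.re) :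
    ‖w‖ < ‖(r : ℂ) + w‖ := by
  refine lt_of_pow_lt_pow_left₀ 2 (norm_nonneg _) ?_
  simp only [← Complex.normSq_eq_norm_sq, Complex.normSq_apply, Complex.add_re, Complex.add_im,
    Complex.ofReal_re, Complex.ofReal_im]
  nlinarith

/-! ### The equation `y - β tanh y = h` -/

/-- The map `y ↦ h + β tanh y` strictly decreases the pseudo-hyperbolic distance
`‖a - b‖ / ‖a + conj b‖` of the right half-plane. -/
lemma norm_add_mul_tanh_sub_mul_lt {β : ℝ} (hβ : 0 < β) {h : ℂ} (hh : 0 < h.re) {a b : ℂ}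
    (ha : 0 < a.re) (hb : 0 < b.re) (hab : a ≠ b) :
    ‖(h + β * Complex.tanh a) - (h + β * Complex.tanh b)‖ * ‖a + starRingEnd ℂ b‖ <
      ‖a - b‖ * ‖(h + β * Complex.tanh a) + starRingEnd ℂ (h + β * Complex.tanh b)‖ := by
  have e1 : (h + β * Complex.tanh a) - (h + β * Complex.tanh b)
      = β * (Complex.tanh a - Complex.tanh b) := by ring
  have e2 : (h + β * Complex.tanh a) + starRingEnd ℂ (h + β * Complex.tanh b)
      = ((2 * h.re : ℝ) : ℂ) + β * (Complex.tanh a + starRingEnd ℂ (Complex.tanh b)) := by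
    rw [map_add, map_mul, Complex.conj_ofReal, ← Complex.add_conj]
    ring
  -- The strictness: `h` cancels in the difference but adds `2 Re h > 0` to the sum.
  have hlt := norm_lt_norm_ofReal_add (show 0 < 2 * h.re by linarith)
    (w := β * (Complex.tanh a + starRingEnd ℂ (Complex.tanh b))) (by
      rw [Complex.re_ofReal_mul, Complex.add_re, Complex.conj_re]
      exact mul_pos hβ (add_pos (tanh_re_pos ha) (tanh_re_pos hb)))
  have hpos : 0 < ‖a - b‖ := norm_pos_iff.2 (sub_ne_zero.2 hab)
  have hβn : ‖(β : ℂ)‖ = β := by rw [Complex.norm_real, Real.norm_of_nonneg hβ.le]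
  rw [e1, e2]
  refine lt_of_le_of_lt ?_ (mul_lt_mul_of_pos_left hlt hpos)
  rw [norm_mul, norm_mul, hβn]
  nlinarith [mul_le_mul_of_nonneg_left (norm_tanh_sub_mul_norm_le ha hb) hβ.le]

lemma sub_mul_tanh_injOn {β : ℝ} (hβ : 0 < β) {h : ℂ} (hh : 0 < h.re) {a b : ℂ}
    (ha : 0 < a.re) (hb : 0 < b.re) (hah : a - β * Complex.tanh a = h)
    (hbh : b - β * Complex.tanh b = h) : a = b := by
  by_contra hab
  have := norm_add_mul_tanh_sub_mul_lt hβ hh ha hb hab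
  rw [← sub_eq_iff_eq_add.1 hah, ← sub_eq_iff_eq_add.1 hbh] at this
  exact lt_irrefl _ this

lemma continuousAt_tanh {z : ℂ} (hz : Complex.cosh z ≠ 0) : ContinuousAt Complex.tanh z := by
  have : Complex.tanh = fun z => Complex.sinh z / Complex.cosh z := by
    funext z; exact Complex.tanh_eq_sinh_div_cosh z
  rw [this]
  exact Complex.continuous_sinh.continuousAt.div Complex.continuous_cosh.continuousAt hz

/-- Edelstein's argument: on a compact invariant set, a minimizer of the pseudo-hyperbolic
displacement from `y` to `T y` is fixed, since otherwise `T y` would have smaller displacement. -/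
lemma exists_sub_mul_tanh_eq {β : ℝ} (hβ : 0 < β) {h : ℂ} (hh : 0 < h.re) :
    ∃ y : ℂ, 0 < y.re ∧ y - β * Complex.tanh y = h := by
  set T : ℂ → ℂ := fun y => h + β * Complex.tanh y with hT
  set K : Set ℂ := {y | h.re ≤ y.re} ∩
    Metric.closedBall h (β * (Real.cosh h.re / Real.sinh h.re)) with hK
  have hKpos : ∀ y ∈ K, 0 < y.re := fun y hy => hh.trans_le hy.1
  have hKc : IsCompact K := (isCompact_closedBall _ _).inter_left
    (isClosed_le continuous_const Complex.continuous_re)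
  have hKn : K.Nonempty := ⟨h, le_refl h.re, Metric.mem_closedBall_self
    (mul_nonneg hβ.le (div_nonneg (Real.cosh_pos _).le (Real.sinh_nonneg_iff.2 hh.le)))⟩
  have hTK : ∀ y ∈ K, T y ∈ K := by
    intro y hy
    constructor
    · simp only [Set.mem_ofPred_eq, hT, Complex.add_re, Complex.re_ofReal_mul]
      have := mul_pos hβ (tanh_re_pos (hKpos y hy))
      linarith
    · rw [mem_closedBall_iff_norm, hT]
      simp only [add_sub_cancel_left, norm_mul, Complex.norm_real, Real.norm_of_nonneg hβ.le]
      exact mul_le_mul_of_nonneg_left (norm_tanh_le hh hy.1) hβ.le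
  have hTc : ContinuousOn T K := fun y hy => (continuousAt_const.add (continuousAt_const.mul
    (continuousAt_tanh (cosh_ne_zero_of_re_pos (hKpos y hy))))).continuousWithinAt
  have hne : ∀ a ∈ K, ∀ b ∈ K, 0 < ‖a + starRingEnd ℂ b‖ := by
    intro a ha b hb
    refine norm_pos_iff.2 fun h0 => ?_
    have := congrArg Complex.re h0
    simp only [Complex.add_re, Complex.conj_re, Complex.zero_re] at this
    linarith [hKpos a ha, hKpos b hb]
  obtain ⟨y, hy, hmin⟩ := hKc.exists_isMinOn hKn
    (f := fun y => ‖y - T y‖ / ‖y + starRingEnd ℂ (T y)‖)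
    (((continuousOn_id.sub hTc).norm).div
      ((continuousOn_id.add (Complex.continuous_conj.comp_continuousOn hTc)).norm)
      fun y hy => (hne y hy _ (hTK y hy)).ne')
  refine ⟨y, hKpos y hy, ?_⟩
  by_contra hyne
  have hyT : y ≠ T y := fun h' => hyne (sub_eq_iff_eq_add.2 h')
  have hlt := norm_add_mul_tanh_sub_mul_lt hβ hh (hKpos y hy) (hKpos _ (hTK y hy)) hyT
  have hle := isMinOn_iff.1 hmin _ (hTK y hy)
  rw [div_le_div_iff₀ (hne y hy _ (hTK y hy)) (hne _ (hTK y hy) _ (hTK _ (hTK y hy)))] at hle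
  exact absurd hlt (not_lt.2 hle)

lemma isZetaSolution_iff {β : ℝ} {h ζ : ℂ} :
    IsZetaSolution β (Complex.I * h) ζ ↔ 0 < (-Complex.I * ζ).re ∧
      (-Complex.I * ζ) - β * Complex.tanh (-Complex.I * ζ) = h := by
  have e : Complex.tan ζ = Complex.tanh (-Complex.I * ζ) * Complex.I := by
    rw [← Complex.tan_mul_I]
    congr 1
    linear_combination ζ * Complex.I_mul_I
  have hI := Complex.I_mul_I
  rw [IsZetaSolution, e]
  refine and_congr (by simp) ⟨fun H => ?_, fun H => ?_⟩
  · linear_combination (-Complex.I) * H +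
      (-h - β * Complex.tanh (-Complex.I * ζ)) * hI
  · linear_combination Complex.I * H + ζ * hI

lemma existsUnique_isZetaSolution {β : ℝ} (hβ : 0 < β) {h : ℂ} (hh : 0 < h.re) :
    ∃! ζ : ℂ, IsZetaSolution β (Complex.I * h) ζ := by
  obtain ⟨y, hy, hyh⟩ := exists_sub_mul_tanh_eq hβ hh
  have e : -Complex.I * (Complex.I * y) = y := by linear_combination (-y) * Complex.I_mul_I
  refine ⟨Complex.I * y, isZetaSolution_iff.2 (by rw [e]; exact ⟨hy, hyh⟩), fun ζ hζ => ?_⟩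
  obtain ⟨h1, h2⟩ := isZetaSolution_iff.1 hζ
  rw [← sub_mul_tanh_injOn hβ hh h1 hy h2 hyh]
  linear_combination ζ * Complex.I_mul_I

/-- The solution `y` of `y - β tanh y = h` in the right half-plane. -/
noncomputable def tanhRoot (β : ℝ) (h : ℂ) : ℂ := -Complex.I * zetaFun β (Complex.I * h)

lemma tanhRoot_spec {β : ℝ} (hβ : 0 < β) {h : ℂ} (hh : 0 < h.re) :
    0 < (tanhRoot β h).re ∧ tanhRoot β h - β * Complex.tanh (tanhRoot β h) = h :=
  isZetaSolution_iff.1 (Classical.epsilon_spec (existsUnique_isZetaSolution hβ hh).exists)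

lemma eq_tanhRoot {β : ℝ} (hβ : 0 < β) {h : ℂ} (hh : 0 < h.re) {y : ℂ} (hy : 0 < y.re)
    (hyh : y - β * Complex.tanh y = h) : y = tanhRoot β h :=
  sub_mul_tanh_injOn hβ hh hy (tanhRoot_spec hβ hh).1 hyh (tanhRoot_spec hβ hh).2

lemma hasStrictDerivAt_sub_mul_tanh (β : ℝ) {y : ℂ} (hy : 0 < y.re) :
    HasStrictDerivAt (fun y => y - β * Complex.tanh y) (1 - β * (1 / Complex.cosh y ^ 2)) y := by
  have hc := cosh_ne_zero_of_re_pos hy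
  have ht : Complex.tanh = fun z => Complex.sinh z / Complex.cosh z := by
    funext z; exact Complex.tanh_eq_sinh_div_cosh z
  have h := (Complex.hasStrictDerivAt_sinh y).fun_div (Complex.hasStrictDerivAt_cosh y) hc
  rw [ht]
  refine (hasStrictDerivAt_id y).fun_sub ((h.const_mul (β : ℂ)).congr_deriv ?_)
  congr 2
  linear_combination Complex.cosh_sq_sub_sinh_sq y

/-- At a critical point `cosh² y = β`, so the image has real part `Re y - sinh (2 Re y) / 2 ≤ 0`. -/
lemma one_sub_mul_ne_zero {β : ℝ} (hβ : 0 < β) {y : ℂ} (hy : 0 < y.re)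
    (hyh : 0 < (y - β * Complex.tanh y).re) : 1 - (β : ℂ) * (1 / Complex.cosh y ^ 2) ≠ 0 := by
  intro h0
  have hc := cosh_ne_zero_of_re_pos hy
  have h1 : Complex.cosh y ^ 2 = β := by field_simp at h0; linear_combination h0
  have h2 : Complex.normSq (Complex.cosh y) = β := by
    rw [Complex.normSq_eq_norm_sq, ← norm_pow, h1, Complex.norm_real, Real.norm_of_nonneg hβ.le]
  rw [Complex.sub_re, Complex.re_ofReal_mul, tanh_re, h2] at hyh
  have h3 : β * (Real.sinh (2 * y.re) / (2 * β)) = Real.sinh (2 * y.re) / 2 := by field_simp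
  have h4 := Real.self_le_sinh_iff.2 (show 0 ≤ 2 * y.re by linarith)
  linarith

/-- By uniqueness, the root coincides near `h` with the differentiable local inverse, whose values
stay in the right half-plane. -/
lemma differentiableAt_tanhRoot {β : ℝ} (hβ : 0 < β) {h : ℂ} (hh : 0 < h.re) :
    DifferentiableAt ℂ (tanhRoot β) h := by
  obtain ⟨hy, hyh⟩ := tanhRoot_spec hβ hh
  have hd := hasStrictDerivAt_sub_mul_tanh β hy
  have hne := one_sub_mul_ne_zero hβ hy (by rw [hyh]; exact hh)
  have hinv := (hd.to_localInverse hne).hasDerivAt.differentiableAt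
  have hright := hd.eventually_right_inverse hne
  have hval := (hd.hasStrictFDerivAt_equiv hne).localInverse_tendsto
  rw [hyh] at hinv hright hval
  refine hinv.congr_of_eventuallyEq ?_
  filter_upwards [hright, hval.eventually ((isOpen_lt continuous_const Complex.continuous_re).mem_nhds hy),
    (isOpen_lt continuous_const Complex.continuous_re).mem_nhds hh] with w hw1 hw2 hw3
  exact (eq_tanhRoot hβ hw3 hw2 hw1).symm

/-! ### Branches of the logarithm -/

lemma isPreconnected_re_pos : IsPreconnected {h : ℂ | 0 < h.re} :=
  (convex_halfSpace_re_gt 0).isPreconnected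

lemma isOpen_re_pos : IsOpen {h : ℂ | 0 < h.re} :=
  isOpen_lt continuous_const Complex.continuous_re

/-- From `exp (L - M) = 1` the difference has zero derivative; realness at `x` makes the constant
vanish. -/
lemma IsLogBranch.eqOn {U : Set ℂ} (hU : IsOpen U) (hc : IsPreconnected U) {x : ℝ}
    (hx : (x : ℂ) ∈ U) {f L M : ℂ → ℂ} (hL : IsLogBranch U f L) (hM : IsLogBranch U f M) :
    Set.EqOn L M U := by
  obtain ⟨hLd, hLe, hLr⟩ := hL
  obtain ⟨hMd, hMe, hMr⟩ := hM
  have hone : ∀ z ∈ U, Complex.exp (L z - M z) = 1 := fun z hz => by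
    rw [Complex.exp_sub, hLe z hz, ← hMe z hz, div_self (Complex.exp_ne_zero _)]
  have hdiff : DifferentiableOn ℂ (fun z => L z - M z) U := hLd.sub hMd
  have hderiv : U.EqOn (deriv fun z => L z - M z) 0 := by
    intro z hz
    have h1 := ((hdiff z hz).differentiableAt (hU.mem_nhds hz)).hasDerivAt.cexp
    have h2 : HasDerivAt (fun z => Complex.exp (L z - M z)) 0 z :=
      (hasDerivAt_const z (1 : ℂ)).congr_of_eventuallyEq (by
        filter_upwards [hU.mem_nhds hz] with w hw using hone w hw)
    simpa [Complex.exp_ne_zero] using h1.unique h2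
  have hx0 : L x = M x := by
    have him : (L x).im = (M x).im := by rw [hLr x hx, hMr x hx]
    refine Complex.ext ?_ him
    have h := congrArg norm ((hLe x hx).trans (hMe x hx).symm)
    rwa [Complex.norm_exp, Complex.norm_exp, Real.exp_eq_exp] at h
  intro z hz
  have := hU.is_const_of_deriv_eq_zero hc hdiff hderiv hz hx
  simp only [hx0, sub_self] at this
  exact sub_eq_zero.1 this

lemma curieWeissZ_neg (n : ℕ) (β : ℝ) (h : ℂ) : curieWeissZ n β (-h) = curieWeissZ n β h := by
  unfold curieWeissZ
  refine Fintype.sum_equiv (Equiv.neg _) _ _ fun σ => ?_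
  simp [Finset.sum_neg_distrib]

lemma IsLogBranch.comp_neg {U V : Set ℂ} (hUV : ∀ z ∈ V, -z ∈ U) {n : ℕ} {β : ℝ} {L : ℂ → ℂ}
    (hL : IsLogBranch U (curieWeissZ n β) L) :
    IsLogBranch V (curieWeissZ n β) fun h => L (-h) := by
  refine ⟨hL.1.comp differentiable_neg.differentiableOn hUV, fun h hh => ?_, fun x hx => ?_⟩
  · rw [hL.2.1 _ (hUV h hh), curieWeissZ_neg]
  · have h := hL.2.2 (-x)
    rw [Complex.ofReal_neg] at h
    exact h (hUV _ hx)

/-- The Curie-Weiss partition function with a real external field. -/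
noncomputable def realCurieWeissZ (n : ℕ) (β x : ℝ) : ℝ :=
  ∑ σ : Fin n → ℤˣ, Real.exp (β / (2 * n) * magnetization σ ^ 2 + x * magnetization σ)

lemma realCurieWeissZ_pos (n : ℕ) (β x : ℝ) : 0 < realCurieWeissZ n β x :=
  Finset.sum_pos (fun _ _ => Real.exp_pos _) Finset.univ_nonempty

lemma curieWeissZ_ofReal (n : ℕ) (β x : ℝ) :
    curieWeissZ n β x = (realCurieWeissZ n β x : ℝ) := by
  rw [curieWeissZ, realCurieWeissZ, Complex.ofReal_sum]
  refine Finset.sum_congr rfl fun σ _ => ?_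
  have hs : ∑ k, ((σ k : ℤ) : ℂ) = (magnetization σ : ℝ) := by
    rw [magnetization, ← sum_spin]; push_cast; rfl
  rw [hs]
  push_cast
  rfl

lemma norm_exp_neg_two_mul_lt_one {h : ℂ} (hh : 0 < h.re) : ‖Complex.exp (-2 * h)‖ < 1 := by
  rw [Complex.norm_exp, Real.exp_lt_one_iff]
  simp [hh]

lemma one_sub_mem_slitPlane {z : ℂ} (hz : ‖z‖ < 1) : 1 - z ∈ Complex.slitPlane := by
  rw [sub_eq_add_neg]
  exact Complex.mem_slitPlane_of_norm_lt_one (by rwa [norm_neg])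

lemma exp_sum_log_one_sub {n : ℕ} {u : Fin n → ℂ} (hu : ∀ i, ‖u i‖ = 1) {z : ℂ} (hz : ‖z‖ < 1) :
    Complex.exp (∑ i, Complex.log (1 - z * u i)) = ∏ i, (1 - z * u i) := by
  rw [Complex.exp_sum]
  refine Finset.prod_congr rfl fun i _ => Complex.exp_log ?_
  exact Complex.slitPlane_ne_zero (one_sub_mem_slitPlane (by rwa [norm_mul, hu, mul_one]))

/-- A continuous logarithm of a positive function on an interval is real if it is real at one
endpoint. -/
lemma im_eq_zero_of_exp_pos {F : ℝ → ℂ} (hF : ContinuousOn F (Set.Icc 0 1)) (h0 : (F 0).im = 0)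
    (hpos : ∀ t ∈ Set.Icc (0 : ℝ) 1, ∃ p : ℝ, 0 < p ∧ Complex.exp (F t) = p) : (F 1).im = 0 := by
  have hcos : ∀ t ∈ Set.Icc (0 : ℝ) 1, Real.cos (F t).im = 1 := by
    intro t ht
    obtain ⟨p, hp, hpe⟩ := hpos t ht
    have h1 := congrArg norm hpe
    have h2 := congrArg Complex.re hpe
    rw [Complex.norm_exp, Complex.norm_real, Real.norm_of_nonneg hp.le] at h1
    rw [Complex.exp_re, h1, Complex.ofReal_re] at h2
    exact (mul_eq_left₀ hp.ne').1 h2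
  have him : ContinuousOn (fun t => (F t).im) (Set.Icc 0 1) :=
    Complex.continuous_im.comp_continuousOn hF
  have hpi := Real.pi_pos
  have h1 := hcos 1 (by simp)
  -- A nonzero imaginary part with cosine 1 has size at least `2π`, so the path would cross `±π`,
  -- where the cosine is `-1`.
  by_contra hne
  rcases lt_or_gt_of_ne hne with h | h
  · have hle : (F 1).im ≤ -(2 * Real.pi) := by
      by_contra hlt
      exact hne ((Real.cos_eq_one_iff_of_lt_of_lt (by linarith) (by linarith)).1 h1)
    obtain ⟨t, ht, hte⟩ := intermediate_value_Icc' zero_le_one him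
      (show -Real.pi ∈ Set.Icc (F 1).im (F 0).im from ⟨by linarith, by linarith⟩)
    have := hcos t ht
    simp only at hte
    rw [hte, Real.cos_neg, Real.cos_pi] at this
    linarith
  · have hle : 2 * Real.pi ≤ (F 1).im := by
      by_contra hlt
      exact hne ((Real.cos_eq_one_iff_of_lt_of_lt (by linarith) (by linarith)).1 h1)
    obtain ⟨t, ht, hte⟩ := intermediate_value_Icc zero_le_one him
      (show Real.pi ∈ Set.Icc (F 0).im (F 1).im from ⟨by linarith, by linarith⟩)
    have := hcos t ht
    simp only at hte
    rw [hte, Real.cos_pi] at this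
    linarith

/-- The branch of the logarithm of the Curie-Weiss partition function on the right half-plane, as a
sum over the Lee-Yang zeros. -/
lemma exists_isLogBranch_eq_sum {n : ℕ} (hn : 1 ≤ n) {β : ℝ} (hβ : 0 < β) :
    ∃ u : Fin n → ℂ, (∀ i, ‖u i‖ = 1) ∧
      IsLogBranch {h : ℂ | 0 < h.re} (curieWeissZ n β) fun h =>
        n * (β / 2 + h) + ∑ i, Complex.log (1 - Complex.exp (-2 * h) * u i) := by
  obtain ⟨u, hu, hZ⟩ := exists_curieWeissZ_eq_prod hn hβ
  refine ⟨u, hu, ?_, fun h hh => ?_, fun x hx => ?_⟩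
  · intro h hh
    refine DifferentiableAt.differentiableWithinAt ?_
    refine (by fun_prop : DifferentiableAt ℂ (fun h : ℂ => (n : ℂ) * (β / 2 + h)) h).add
      (DifferentiableAt.fun_sum fun i _ => DifferentiableAt.clog (by fun_prop)
        (one_sub_mem_slitPlane ?_))
    rw [norm_mul, hu, mul_one]
    exact norm_exp_neg_two_mul_lt_one hh
  · rw [Complex.exp_add, exp_sum_log_one_sub hu (norm_exp_neg_two_mul_lt_one hh), hZ]
  · have hx0 : 0 < x := by simpa using hx
    have hpos : ∀ r : ℝ, 0 ≤ r → ∃ p : ℝ, 0 < p ∧ ∏ i, (1 - (r : ℂ) * u i) = p := by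
      intro r hr
      rcases hr.eq_or_lt with rfl | hr
      · exact ⟨1, one_pos, by simp⟩
      -- The field with `exp (-2h) = r` is real, so the product is a positive partition function
      -- over a positive exponential.
      have h := hZ ((-(Real.log r) / 2 : ℝ) : ℂ)
      have e1 : Complex.exp (-2 * ((-(Real.log r) / 2 : ℝ) : ℂ)) = r := by
        rw [← Real.exp_log hr, Complex.ofReal_exp, Real.exp_log hr]
        push_cast
        congr 1
        ring
      have e2 : Complex.exp (n * (β / 2 + ((-(Real.log r) / 2 : ℝ) : ℂ)))
          = (Real.exp (n * (β / 2 + -(Real.log r) / 2)) : ℝ) := by push_cast; rfl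
      rw [e1, e2, curieWeissZ_ofReal] at h
      refine ⟨realCurieWeissZ n β (-(Real.log r) / 2) /
        Real.exp (n * (β / 2 + -(Real.log r) / 2)),
        div_pos (realCurieWeissZ_pos _ _ _) (Real.exp_pos _), ?_⟩
      rw [Complex.ofReal_div, h, mul_div_cancel_left₀]
      exact_mod_cast (Real.exp_pos _).ne'
    have hr1 : Real.exp (-2 * x) < 1 := by rw [Real.exp_lt_one_iff]; linarith
    have hnorm : ∀ t ∈ Set.Icc (0 : ℝ) 1, ‖((t * Real.exp (-2 * x) : ℝ) : ℂ)‖ < 1 := by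
      intro t ht
      rw [Complex.norm_real, Real.norm_of_nonneg (mul_nonneg ht.1 (Real.exp_pos _).le)]
      exact (mul_le_of_le_one_left (Real.exp_pos _).le ht.2).trans_lt hr1
    -- The path runs from `0`, where every logarithm vanishes, to `exp (-2x)`.
    have key := im_eq_zero_of_exp_pos
      (F := fun t => ∑ i, Complex.log (1 - ((t * Real.exp (-2 * x) : ℝ) : ℂ) * u i)) (by
        refine continuousOn_finsetSum _ fun i _ => ContinuousOn.clog (by fun_prop) fun t ht => ?_
        refine one_sub_mem_slitPlane ?_
        rw [norm_mul, hu, mul_one]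
        exact hnorm t ht) (by simp) (fun t ht => by
        rw [exp_sum_log_one_sub hu (hnorm t ht)]
        exact hpos _ (mul_nonneg ht.1 (Real.exp_pos _).le))
    rw [Complex.add_im]
    have e3 : ((Real.exp (-2 * x) : ℝ) : ℂ) = Complex.exp (-2 * (x : ℂ)) := by push_cast; rfl
    simp only [one_mul, e3] at key
    rw [key, add_zero]
    have e4 : (n : ℂ) * (β / 2 + x) = ((n * (β / 2 + x) : ℝ) : ℂ) := by push_cast; rfl
    rw [e4, Complex.ofReal_im]

/-! ### Mean-field asymptotics for real fields -/

lemma sum_exp_mul_magnetization (n : ℕ) (t : ℝ) :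
    ∑ σ : Fin n → ℤˣ, Real.exp (t * magnetization σ) = (2 * Real.cosh t) ^ n := by
  have h1 : ∀ σ : Fin n → ℤˣ,
      Real.exp (t * magnetization σ) = ∏ i, Real.exp (t * ((σ i : ℤ) : ℝ)) := by
    intro σ
    rw [magnetization, ← sum_spin, Finset.mul_sum, Real.exp_sum]
  simp_rw [h1]
  have h2 := Finset.prod_univ_sum (fun _ : Fin n => (Finset.univ : Finset ℤˣ))
    (fun _ s => Real.exp (t * ((s : ℤ) : ℝ)))
  rw [Fintype.piFinset_univ] at h2
  rw [← h2]
  have h3 : (∑ s : ℤˣ, Real.exp (t * ((s : ℤ) : ℝ))) = 2 * Real.cosh t := by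
    have : (Finset.univ : Finset ℤˣ) = {1, -1} := by decide
    rw [this, Finset.sum_pair (by decide), Real.cosh_eq]
    simp
    ring
  rw [h3]
  simp

/-- The mean-field functional of the Curie-Weiss model. -/
noncomputable def meanField (β x m : ℝ) : ℝ := -(β * m ^ 2 / 2) + Real.log (2 * Real.cosh (β * m + x))

/-- Replacing `S²` by its tangent at `n m` decouples the spins; both bounds on the partition
function compare with this sum. -/
lemma exp_mul_meanField (n : ℕ) (β x m : ℝ) :
    Real.exp (n * meanField β x m) =
      ∑ σ : Fin n → ℤˣ, Real.exp (-(n * β * m ^ 2 / 2) + (β * m + x) * magnetization σ) := by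
  simp_rw [Real.exp_add]
  have hc : 0 < 2 * Real.cosh (β * m + x) := by have := Real.cosh_pos (β * m + x); linarith
  rw [← Finset.mul_sum, sum_exp_mul_magnetization, meanField, mul_add, Real.exp_add,
    Real.exp_nat_mul (Real.log _), Real.exp_log hc]
  congr 2
  ring

lemma exp_mul_meanField_le {n : ℕ} (hn : 1 ≤ n) {β : ℝ} (hβ : 0 < β) (x m : ℝ) :
    Real.exp (n * meanField β x m) ≤ realCurieWeissZ n β x := by
  rw [exp_mul_meanField, realCurieWeissZ]
  refine Finset.sum_le_sum fun σ _ => Real.exp_le_exp.2 ?_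
  have hn' : (0 : ℝ) < n := by exact_mod_cast hn
  have e : β / (2 * n) * magnetization σ ^ 2 + x * magnetization σ
      - (-(n * β * m ^ 2 / 2) + (β * m + x) * magnetization σ)
      = β / (2 * n) * (magnetization σ - n * m) ^ 2 := by
    field_simp
    ring
  have : 0 ≤ β / (2 * n) * (magnetization σ - n * m) ^ 2 := by positivity
  linarith

/-- The tangent is exact at `m = S / n`, and `S` takes only `n + 1` values, so summing over all of
them dominates each Boltzmann weight. -/
lemma realCurieWeissZ_le {n : ℕ} (hn : 1 ≤ n) {β x M : ℝ}
    (hM : ∀ m, meanField β x m ≤ M) : realCurieWeissZ n β x ≤ (n + 1) * Real.exp (n * M) := by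
  have hn' : (0 : ℝ) < n := by exact_mod_cast hn
  calc realCurieWeissZ n β x
      ≤ ∑ σ : Fin n → ℤˣ, ∑ k ∈ Finset.range (n + 1),
          Real.exp (-(n * β * ((n - 2 * k) / n : ℝ) ^ 2 / 2)
            + (β * ((n - 2 * k) / n) + x) * magnetization σ) := by
        refine Finset.sum_le_sum fun σ _ => ?_
        refine le_trans (le_of_eq ?_) (Finset.single_le_sum (fun _ _ => (Real.exp_pos _).le)
          (Finset.mem_range.2 (Nat.lt_succ_of_le (downCount_le σ))))
        congr 1
        rw [magnetization]
        field_simp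
        ring
    _ = ∑ k ∈ Finset.range (n + 1), Real.exp (n * meanField β x ((n - 2 * k) / n)) := by
        rw [Finset.sum_comm]
        simp_rw [exp_mul_meanField]
    _ ≤ ∑ _k ∈ Finset.range (n + 1), Real.exp (n * M) :=
        Finset.sum_le_sum fun k _ => Real.exp_le_exp.2 (mul_le_mul_of_nonneg_left (hM _) hn'.le)
    _ = (n + 1) * Real.exp (n * M) := by simp

lemma tendsto_log_realCurieWeissZ_div {β x m : ℝ} (hβ : 0 < β)
    (hm : ∀ m', meanField β x m' ≤ meanField β x m) :
    Tendsto (fun n : ℕ => Real.log (realCurieWeissZ n β x) / n) atTop (𝓝 (meanField β x m)) := by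
  have hlog : Tendsto (fun n : ℕ => Real.log (n + 1) / n) atTop (𝓝 0) := by
    -- This is `log t / (t - 1)` at `t = n + 1`.
    have h := (Real.tendsto_pow_log_div_mul_add_atTop 1 (-1) 1 one_ne_zero).comp
      (tendsto_atTop_add_const_right _ 1 (tendsto_natCast_atTop_atTop (R := ℝ)))
    refine h.congr fun n => ?_
    simp
  have hup := (tendsto_const_nhds (x := meanField β x m)).add hlog
  rw [add_zero] at hup
  refine tendsto_of_tendsto_of_tendsto_of_le_of_le' tendsto_const_nhds hup ?_ ?_
  · filter_upwards [eventually_ge_atTop 1] with n hn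
    have hn' : (0 : ℝ) < n := by exact_mod_cast hn
    rw [le_div_iff₀ hn', mul_comm, Real.le_log_iff_exp_le (realCurieWeissZ_pos _ _ _)]
    exact exp_mul_meanField_le hn hβ x m
  · filter_upwards [eventually_ge_atTop 1] with n hn
    have hn' : (0 : ℝ) < n := by exact_mod_cast hn
    have h := Real.log_le_log (realCurieWeissZ_pos _ _ _) (realCurieWeissZ_le hn hm)
    rw [Real.log_mul (by positivity) (Real.exp_pos _).ne', Real.log_exp] at h
    rw [div_le_iff₀ hn', add_mul, div_mul_cancel₀ _ hn'.ne']
    linarith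

lemma hasDerivAt_meanField (β x m : ℝ) :
    HasDerivAt (meanField β x) (β * (Real.tanh (β * m + x) - m)) m := by
  have hc : 0 < Real.cosh (β * m + x) := Real.cosh_pos _
  have hlin : HasDerivAt (fun m => β * m + x) β m := by
    simpa using ((hasDerivAt_id m).const_mul β).add_const x
  have h1 := ((hlin.cosh.const_mul 2).log (by positivity))
  have h2 := (((hasDerivAt_pow 2 m).const_mul β).div_const 2).fun_neg
  refine (h2.fun_add h1).congr_deriv ?_
  rw [Real.tanh_eq_sinh_div_cosh]
  field_simp
  simp
  ring

lemma cosh_le_exp_abs (t : ℝ) : Real.cosh t ≤ Real.exp |t| := by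
  rw [← Real.cosh_abs, Real.cosh_eq]
  have := Real.exp_le_exp.2 (show -|t| ≤ |t| by linarith [abs_nonneg t])
  linarith

lemma meanField_le_abs {β x : ℝ} (hβ : 0 < β) (hx : 0 < x) (m : ℝ) :
    meanField β x m ≤ meanField β x |m| := by
  have hc := Real.cosh_pos (β * m + x)
  have h : Real.cosh (β * m + x) ≤ Real.cosh (β * |m| + x) := by
    rw [Real.cosh_le_cosh, abs_of_nonneg (a := β * |m| + x) (by positivity)]
    refine (abs_add_le _ _).trans (le_of_eq ?_)
    rw [abs_mul, abs_of_pos hβ, abs_of_pos hx]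
  rw [meanField, meanField, sq_abs]
  have := Real.log_le_log (by linarith) (mul_le_mul_of_nonneg_left h (zero_le_two (α := ℝ)))
  linarith

/-- Coercivity: the logarithm is at most `log 2 + β |m| + x`, and the threshold makes `β m² / 2`
absorb `β |m| + x`. -/
lemma meanField_le_zero {β x m : ℝ} (hβ : 0 < β) (hx : 0 < x) (hm : 2 + 2 * x / β ≤ |m|) :
    meanField β x m ≤ meanField β x 0 := by
  have hxβ : 0 < x / β := by positivity
  rw [mul_div_assoc] at hm
  have h0 : Real.log 2 ≤ meanField β x 0 := by
    rw [meanField]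
    have := Real.log_le_log two_pos (show (2 : ℝ) ≤ 2 * Real.cosh (β * 0 + x) by
      linarith [Real.one_le_cosh (β * 0 + x)])
    simpa using this
  have h1 : Real.log (2 * Real.cosh (β * m + x)) ≤ Real.log 2 + (β * |m| + x) := by
    rw [Real.log_mul two_ne_zero (Real.cosh_pos _).ne']
    have h2 := Real.log_le_log (Real.cosh_pos _) (cosh_le_exp_abs (β * m + x))
    rw [Real.log_exp] at h2
    have h3 := abs_add_le (β * m) x
    rw [abs_mul, abs_of_pos hβ, abs_of_pos hx] at h3
    linarith
  have h4 : β * |m| + x ≤ β * m ^ 2 / 2 := by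
    rw [← sq_abs]
    have hx' : x = β * (x / β) := by field_simp
    nlinarith [mul_nonneg hβ.le (mul_nonneg (abs_nonneg m) (sub_nonneg.2 hm)),
      mul_nonneg hβ.le (mul_nonneg hxβ.le (show 0 ≤ |m| - 1 by linarith))]
  rw [meanField]
  linarith

/-- The sign of `m` matters: it puts `β m + x` in the right half-plane, where the root is unique. -/
lemma exists_meanField_max {β x : ℝ} (hβ : 0 < β) (hx : 0 < x) :
    ∃ m, 0 ≤ m ∧ m = Real.tanh (β * m + x) ∧ ∀ m', meanField β x m' ≤ meanField β x m := by
  set R := 2 + 2 * x / β with hR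
  have hR0 : 0 < R := by positivity
  have hcont : Continuous (meanField β x) :=
    continuous_iff_continuousAt.2 fun m => (hasDerivAt_meanField β x m).continuousAt
  obtain ⟨m, hm, hmax⟩ := isCompact_Icc.exists_isMaxOn (Set.nonempty_Icc.2 (by linarith : -R ≤ R))
    hcont.continuousOn
  have hglob : ∀ m', meanField β x m' ≤ meanField β x |m| := by
    intro m'
    refine le_trans ?_ (meanField_le_abs hβ hx m)
    by_cases h : |m'| ≤ R
    · exact isMaxOn_iff.1 hmax m' (abs_le.1 h)
    · exact (meanField_le_zero hβ hx (not_le.1 h).le).trans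
        (isMaxOn_iff.1 hmax 0 ⟨by linarith, hR0.le⟩)
  refine ⟨|m|, abs_nonneg m, ?_, hglob⟩
  have hloc : IsLocalMax (meanField β x) |m| := Eventually.of_forall hglob
  have := hloc.hasDerivAt_eq_zero (hasDerivAt_meanField β x |m|)
  have h := (mul_eq_zero.1 this).resolve_left hβ.ne'
  linarith

/-! ### The limiting free energy -/

lemma curieWeissFreeEnergy_eq (β : ℝ) (h : ℂ) :
    curieWeissFreeEnergy β h = (β : ℂ) / 2 + h
      + Complex.log (1 + Complex.exp (-2 * tanhRoot β h))
      - 2 * (β : ℂ) / (1 + Complex.exp (2 * tanhRoot β h)) ^ 2 := by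
  have e1 : -2 * tanhRoot β h = 2 * Complex.I * zetaFun β (Complex.I * h) := by
    rw [tanhRoot]; ring
  have e2 : 2 * tanhRoot β h = -(2 * Complex.I * zetaFun β (Complex.I * h)) := by
    rw [tanhRoot]; ring
  rw [curieWeissFreeEnergy, e1, e2]

lemma tanh_eq_one_sub (y : ℝ) : Real.tanh y = 1 - 2 / (1 + Real.exp (2 * y)) := by
  rw [Real.tanh_eq_sinh_div_cosh, Real.sinh_eq, Real.cosh_eq, Real.exp_neg, two_mul y, Real.exp_add]
  have := Real.exp_pos y
  field_simp
  ring

lemma curieWeissFreeEnergy_ofReal {β x m : ℝ} (hβ : 0 < β) (hx : 0 < x) (hm0 : 0 ≤ m)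
    (hm : m = Real.tanh (β * m + x)) :
    curieWeissFreeEnergy β x = (meanField β x m : ℝ) := by
  set y := β * m + x with hy
  have hy0 : 0 < y := by positivity
  have hroot : ((y : ℝ) : ℂ) = tanhRoot β x := by
    refine eq_tanhRoot hβ (by simpa using hx) (by simpa using hy0) ?_
    rw [← Complex.ofReal_tanh, ← hm, hy]
    push_cast
    ring
  have hE := Real.exp_pos (2 * y)
  have hE' := Real.exp_pos (-2 * y)
  have hreal : meanField β x m = β / 2 + x + Real.log (1 + Real.exp (-2 * y))
      - 2 * β / (1 + Real.exp (2 * y)) ^ 2 := by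
    have hcosh : 2 * Real.cosh y = Real.exp y * (1 + Real.exp (-2 * y)) := by
      rw [Real.cosh_eq, mul_add, ← Real.exp_add, show y + -2 * y = -y by ring]
      ring
    -- This turns the last term of the free energy into `β (1 - m)² / 2`.
    have htanh : 2 / (1 + Real.exp (2 * y)) = 1 - m := by
      have := tanh_eq_one_sub y
      linarith
    rw [meanField, ← hy, hcosh, Real.log_mul (Real.exp_pos _).ne' (by positivity), Real.log_exp]
    have ht : 2 * β / (1 + Real.exp (2 * y)) ^ 2 = β / 2 * (2 / (1 + Real.exp (2 * y))) ^ 2 := by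
      field_simp
    rw [ht, htanh]
    linear_combination hy
  rw [curieWeissFreeEnergy_eq, ← hroot, hreal]
  push_cast
  rw [Complex.ofReal_log (by positivity)]
  push_cast
  rfl

lemma differentiableAt_curieWeissFreeEnergy {β : ℝ} (hβ : 0 < β) {h : ℂ} (hh : 0 < h.re) :
    DifferentiableAt ℂ (curieWeissFreeEnergy β) h := by
  have hy := (tanhRoot_spec hβ hh).1
  have hd := differentiableAt_tanhRoot hβ hh
  have hfun : curieWeissFreeEnergy β = fun h => (β : ℂ) / 2 + h
      + Complex.log (1 + Complex.exp (-2 * tanhRoot β h))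
      - 2 * (β : ℂ) / (1 + Complex.exp (2 * tanhRoot β h)) ^ 2 :=
    funext (curieWeissFreeEnergy_eq β)
  rw [hfun]
  have h1 : 1 + Complex.exp (-2 * tanhRoot β h) ∈ Complex.slitPlane :=
    Complex.mem_slitPlane_of_norm_lt_one (norm_exp_neg_two_mul_lt_one hy)
  have h2 : 1 + Complex.exp (2 * tanhRoot β h) ≠ 0 := by
    intro h0
    have h3 := congrArg norm (eq_neg_of_add_eq_zero_right h0)
    rw [norm_neg, norm_one, Complex.norm_exp, Real.exp_eq_one_iff] at h3
    simp at h3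
    exact hy.ne' h3
  refine ((differentiableAt_id.const_add _).fun_add ?_).fun_sub ?_
  · exact DifferentiableAt.clog (by fun_prop) h1
  · exact (differentiableAt_const _).fun_div (by fun_prop) (pow_ne_zero 2 h2)

/-! ### From real fields to the half-plane -/

lemma norm_mul_exp_pow_le {c : ℂ} (hc : ‖c‖ ≤ 1) {δ : ℝ} {h : ℂ} (hh : δ ≤ h.re) (k : ℕ) :
    ‖c * Complex.exp (-2 * h) ^ k‖ ≤ Real.exp (-2 * δ) ^ k := by
  rw [norm_mul, norm_pow, Complex.norm_exp]
  refine (mul_le_of_le_one_left (by positivity) hc).trans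
    (pow_le_pow_left₀ (Real.exp_pos _).le (Real.exp_le_exp.2 ?_) k)
  simp
  exact hh

lemma summable_exp_pow {δ : ℝ} (hδ : 0 < δ) : Summable fun k : ℕ => Real.exp (-2 * δ) ^ k :=
  summable_geometric_of_lt_one (Real.exp_pos _).le (by rw [Real.exp_lt_one_iff]; linarith)

/-- A Vitali-type theorem: power series in `exp (-2 h)` with bounded coefficients that converge on
the positive reals to an analytic function converge to it on the right half-plane. -/
lemma tendsto_tsum_exp_of_tendsto_real {a : ℕ → ℕ → ℂ} (ha : ∀ n k, ‖a n k‖ ≤ 1) {Φ : ℂ → ℂ}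
    (hΦ : DifferentiableOn ℂ Φ {h | 0 < h.re})
    (hreal : ∀ x : ℝ, 0 < x →
      Tendsto (fun n => ∑' k, a n k * Complex.exp (-2 * (x : ℂ)) ^ k) atTop (𝓝 (Φ x)))
    {h : ℂ} (hh : 0 < h.re) :
    Tendsto (fun n => ∑' k, a n k * Complex.exp (-2 * h) ^ k) atTop (𝓝 (Φ h)) := by
  -- Along an ultrafilter all bounded coefficient sequences converge at once, which replaces a
  -- diagonal subsequence.
  rw [tendsto_iff_ultrafilter]
  intro g hg
  have hb : ∀ k, ∃ b : ℂ, ‖b‖ ≤ 1 ∧ Tendsto (fun n => a n k) g (𝓝 b) := by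
    intro k
    obtain ⟨b, hb, hgb⟩ := (isCompact_closedBall (0 : ℂ) 1).ultrafilter_le_nhds'
      (g.map fun n => a n k) (Ultrafilter.mem_map.2 (Filter.Eventually.of_forall fun n => by
        simpa using ha n k))
    exact ⟨b, by simpa using hb, hgb⟩
  choose b hb1 hb using hb
  have hlim : ∀ h : ℂ, 0 < h.re → Tendsto (fun n => ∑' k, a n k * Complex.exp (-2 * h) ^ k) g
      (𝓝 (∑' k, b k * Complex.exp (-2 * h) ^ k)) := fun h hh =>
    tendsto_tsum_of_dominated_convergence (summable_exp_pow hh)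
      (fun k => (hb k).mul_const _)
      (Eventually.of_forall fun n k => norm_mul_exp_pow_le (ha n k) le_rfl k)
  have hdiff : DifferentiableOn ℂ (fun h => ∑' k, b k * Complex.exp (-2 * h) ^ k)
      {h | 0 < h.re} := by
    intro z hz
    -- Halving the real part leaves a neighbourhood of `z` with one geometric majorant.
    have hz' : 0 < z.re / 2 := half_pos hz
    have hopen : IsOpen {h : ℂ | z.re / 2 < h.re} := isOpen_lt continuous_const Complex.continuous_re
    have hd := Complex.differentiableOn_tsum_of_summable_norm (summable_exp_pow hz')
      (F := fun k h => b k * Complex.exp (-2 * h) ^ k) (U := {h : ℂ | z.re / 2 < h.re})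
      (fun k => by fun_prop) hopen
      (fun k w hw => norm_mul_exp_pow_le (hb1 k) (le_of_lt hw) k)
    have hmem : z ∈ {h : ℂ | z.re / 2 < h.re} := half_lt_self (show 0 < z.re from hz)
    exact ((hd z hmem).differentiableAt (hopen.mem_nhds hmem)).differentiableWithinAt
  have heq : Set.EqOn (fun h => ∑' k, b k * Complex.exp (-2 * h) ^ k) Φ {h | 0 < h.re} := by
    refine (hdiff.analyticOnNhd isOpen_re_pos).eqOn_of_preconnected_of_frequently_eq
      (hΦ.analyticOnNhd isOpen_re_pos) isPreconnected_re_pos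
      (z₀ := ((1 : ℝ) : ℂ)) (by simp) ?_
    have hreal' : ∀ x : ℝ, 0 < x → ∑' k, b k * Complex.exp (-2 * (x : ℂ)) ^ k = Φ x :=
      fun x hx => tendsto_nhds_unique (hlim x (by simpa using hx)) ((hreal x hx).mono_left hg)
    have ht : Tendsto (fun x : ℝ => (x : ℂ)) (𝓝[≠] 1) (𝓝[≠] ((1 : ℝ) : ℂ)) :=
      Complex.continuous_ofReal.continuousWithinAt.tendsto_nhdsWithin fun x hx => by
        simpa using hx
    refine ht.frequently (Eventually.frequently ?_)
    filter_upwards [nhdsWithin_le_nhds (lt_mem_nhds (zero_lt_one' ℝ))] with x hx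
    exact hreal' x hx
  rw [← heq hh]
  exact hlim h hh

/-- Taylor expansion of each Lee–Yang factor's logarithm. The guards `1 ≤ n` let coefficients be
chosen for every `n`, with the zero series at `n = 0`. -/
lemma exists_coeff_of_isLogBranch {n : ℕ} {β : ℝ} (hβ : 0 < β) {L : ℂ → ℂ}
    (hL : 1 ≤ n → IsLogBranch {h : ℂ | 0 < h.re} (curieWeissZ n β) L) :
    ∃ a : ℕ → ℂ, (∀ k, ‖a k‖ ≤ 1) ∧ (1 ≤ n → ∀ h : ℂ, 0 < h.re →
      (1 / (n : ℂ)) * L h = β / 2 + h + ∑' k, a k * Complex.exp (-2 * h) ^ k) := by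
  by_cases hn : 1 ≤ n
  swap
  · exact ⟨0, by simp, fun h => absurd h hn⟩
  have hn' : (0 : ℝ) < n := by exact_mod_cast hn
  obtain ⟨u, hu, hbr⟩ := exists_isLogBranch_eq_sum hn hβ
  refine ⟨fun k => -(1 / (n : ℂ)) * ∑ i, u i ^ k / k, fun k => ?_, fun _ h hh => ?_⟩
  · have h1 : ‖∑ i, u i ^ k / (k : ℂ)‖ ≤ ∑ _i : Fin n, (1 : ℝ) := by
      refine norm_sum_le_of_le _ fun i _ => ?_
      rw [norm_div, norm_pow, hu, one_pow, Complex.norm_natCast]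
      -- At `k = 0` the term is `1 / 0 = 0`.
      rcases Nat.eq_zero_or_pos k with rfl | hk
      · simp
      · rw [div_le_one (by exact_mod_cast hk)]
        exact_mod_cast hk
    simp only [Finset.sum_const, Finset.card_univ, Fintype.card_fin, nsmul_eq_mul, mul_one] at h1
    rw [norm_mul, norm_neg, norm_div, norm_one, Complex.norm_natCast, one_div, inv_mul_le_one₀ hn']
    exact h1
  · have hz := norm_exp_neg_two_mul_lt_one hh
    rw [(hL hn).eqOn isOpen_re_pos isPreconnected_re_pos (x := 1) (by simp) hbr hh]
    have hsum : HasSum (fun k : ℕ => ∑ i, (Complex.exp (-2 * h) * u i) ^ k / k)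
        (∑ i, -Complex.log (1 - Complex.exp (-2 * h) * u i)) :=
      hasSum_sum fun i _ => Complex.hasSum_taylorSeries_neg_log (by rwa [norm_mul, hu, mul_one])
    have hsum' := hsum.mul_left (-(1 / (n : ℂ)))
    have e : (fun k : ℕ => -(1 / (n : ℂ)) * (∑ i, u i ^ k / k) * Complex.exp (-2 * h) ^ k)
        = fun k : ℕ => -(1 / (n : ℂ)) * ∑ i, (Complex.exp (-2 * h) * u i) ^ k / k := by
      funext k
      rw [mul_assoc, Finset.sum_mul]
      congr 1
      refine Finset.sum_congr rfl fun i _ => ?_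
      rw [mul_pow]
      ring
    rw [e, hsum'.tsum_eq, Finset.sum_neg_distrib]
    have hn0 : (n : ℂ) ≠ 0 := by exact_mod_cast hn'.ne'
    field_simp

lemma IsLogBranch.ofReal_eq {n : ℕ} {β : ℝ} {L : ℂ → ℂ}
    (hL : IsLogBranch {h : ℂ | 0 < h.re} (curieWeissZ n β) L) {x : ℝ} (hx : 0 < x) :
    L x = (Real.log (realCurieWeissZ n β x) : ℝ) := by
  have hmem : (x : ℂ) ∈ {h : ℂ | 0 < h.re} := by simpa using hx
  refine Complex.ext ?_ (by rw [hL.2.2 x hmem, Complex.ofReal_im])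
  have h := congrArg norm ((hL.2.1 x hmem).trans (curieWeissZ_ofReal n β x))
  rw [Complex.norm_exp, Complex.norm_real, Real.norm_of_nonneg (realCurieWeissZ_pos _ _ _).le] at h
  rw [← h, Real.log_exp, Complex.ofReal_re]

lemma tendsto_isLogBranch_div {β : ℝ} (hβ : 0 < β) {L : ℕ → ℂ → ℂ}
    (hL : ∀ n, 1 ≤ n → IsLogBranch {h : ℂ | 0 < h.re} (curieWeissZ n β) (L n)) {h : ℂ}
    (hh : 0 < h.re) :
    Tendsto (fun n : ℕ => (1 / (n : ℂ)) * L n h) atTop (𝓝 (curieWeissFreeEnergy β h)) := by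
  choose a ha haL using fun n => exists_coeff_of_isLogBranch hβ (hL n)
  have key := tendsto_tsum_exp_of_tendsto_real ha
    (Φ := fun h => curieWeissFreeEnergy β h - (β / 2 + h))
    (fun z hz => ((differentiableAt_curieWeissFreeEnergy hβ hz).fun_sub
      (by fun_prop)).differentiableWithinAt) (fun x hx => by
      obtain ⟨m, hm0, hm, hmax⟩ := exists_meanField_max hβ hx
      have h1 := ((Complex.continuous_ofReal.tendsto _).comp
        (tendsto_log_realCurieWeissZ_div hβ hmax)).sub_const ((β : ℂ) / 2 + x)
      rw [← curieWeissFreeEnergy_ofReal hβ hx hm0 hm] at h1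
      refine h1.congr' ?_
      filter_upwards [eventually_ge_atTop 1] with n hn
      have h2 := haL n hn x (by simpa using hx)
      rw [(hL n hn).ofReal_eq hx] at h2
      rw [← sub_eq_iff_eq_add'.2 h2]
      simp only [Function.comp, Complex.ofReal_div, Complex.ofReal_natCast]
      ring) hh
  have key' := key.const_add ((β : ℂ) / 2 + h)
  rw [add_sub_cancel] at key'
  refine key'.congr' ?_
  filter_upwards [eventually_ge_atTop 1] with n hn
  exact (haL n hn h hh).symm

theorem mainTheorem7 (β : ℝ) (hβ : 0 < β) :
    (∀ n : ℕ, 1 ≤ n →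
      (∃ L : ℂ → ℂ, IsLogBranch {h : ℂ | 0 < h.re} (curieWeissZ n β) L) ∧
      (∃ L : ℂ → ℂ, IsLogBranch {h : ℂ | h.re < 0} (curieWeissZ n β) L)) ∧
    (∀ h : ℂ, 0 < h.re → ∃! ζ : ℂ, IsZetaSolution β (Complex.I * h) ζ) ∧
    (∀ Lpos Lneg : ℕ → ℂ → ℂ,
      (∀ n : ℕ, 1 ≤ n → IsLogBranch {h : ℂ | 0 < h.re} (curieWeissZ n β) (Lpos n)) →
      (∀ n : ℕ, 1 ≤ n → IsLogBranch {h : ℂ | h.re < 0} (curieWeissZ n β) (Lneg n)) →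
      ∀ h : ℂ, 0 < h.re →
        Tendsto (fun n : ℕ => (1 / (n : ℂ)) * Lpos n h) atTop (𝓝 (curieWeissFreeEnergy β h)) ∧
        Tendsto (fun n : ℕ => (1 / (n : ℂ)) * Lneg n (-h)) atTop
          (𝓝 (curieWeissFreeEnergy β h))) := by
  refine ⟨fun n hn => ?_, fun h hh => existsUnique_isZetaSolution hβ hh,
    fun Lpos Lneg hpos hneg h hh => ⟨tendsto_isLogBranch_div hβ hpos hh, ?_⟩⟩
  · obtain ⟨u, -, hL⟩ := exists_isLogBranch_eq_sum hn hβ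
    exact ⟨⟨_, hL⟩, _, hL.comp_neg fun z (hz : z.re < 0) => by simpa using hz⟩
  -- Since `Z_n` is even in `h`, `h ↦ Lneg n (-h)` is a branch on the right half-plane.
  · exact tendsto_isLogBranch_div hβ (L := fun n h => Lneg n (-h))
      (fun n hn => (hneg n hn).comp_neg fun z (hz : 0 < z.re) => by simpa using hz) hh
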